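/- Let $C\subseteq\mathbb F_2^{60}$ be a linear code with weight enumerator $W_C(y)=\sum_{c\in C}y^{\mathrm{wt}(c)}=\sum_{i=0}^{60}A_iy^i$, where $\mathrm{wt}$ is the Hamming weight. Call $C$ cubic if it is invariant under the cyclic shift of the coordinates by $20=60/3$ places, i.e. if it is $20$-quasi-cyclic of length $3\cdot 20$. Then there is no binary cubic self-dual (with respect to the Euclidean inner product) $[60,30,12]$ code whose weight enumerator is of the form $$W_4 = 1+3451\,y^{12}+24128\,y^{14}+336081\,y^{16}+\cdots,$$ where the dots stand for arbitrary terms of degree greater than $16$. -/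

import Mathlib

open Polynomial

/-- The Euclidean dual of a linear code. -/
def dualCode {F : Type*} [Field F] {n : ℕ} (C : Submodule F (Fin n → F)) :
    Submodule F (Fin n → F) where
  carrier := {u | ∀ v ∈ C, u ⬝ᵥ v = 0}
  add_mem' := by
    intro a b ha hb v hv
    rw [add_dotProduct, ha v hv, hb v hv, add_zero]
  zero_mem' := by
    intro v _
    exact zero_dotProduct v
  smul_mem' := by
    intro r a ha v hv
    rw [smul_dotProduct, ha v hv, smul_zero]

/-- A linear code is self-dual if it equals its Euclidean dual. -/
def IsSelfDualCode {F : Type*} [Field F] {n : ℕ} (C : Submodule F (Fin n → F)) : Prop :=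
  C = dualCode C

/-- The minimum Hamming distance between two distinct codewords. -/
noncomputable def minDistance {F : Type*} [Field F] [DecidableEq F] {n : ℕ}
    (C : Submodule F (Fin n → F)) : ℕ :=
  sInf {d | ∃ u ∈ C, ∃ v ∈ C, u ≠ v ∧ hammingDist u v = d}

/-- `C` is an `[n, k, d]`-linear code. -/
def IsLinearCode {F : Type*} [Field F] [DecidableEq F] {n : ℕ} (k d : ℕ)
    (C : Submodule F (Fin n → F)) : Prop :=
  Module.finrank F C = k ∧ minDistance C = d

/-- The cyclic shift `(c₀, c₁, …, cₙ₋₁) ↦ (cₙ₋₁, c₀, …, cₙ₋₂)`. -/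
def cyclicShift {F : Type*} {n : ℕ} (c : Fin n → F) : Fin n → F :=
  fun k => c ((finRotate n).symm k)

/-- `C` is an `ℓ`-quasi-cyclic code of length `ℓ m`: the length is the product of `ℓ` and `m`, where
`m` is positive and coprime to the characteristic, and `C` is invariant under the `ℓ`-fold
cyclic shift. -/
def IsQuasiCyclic {F : Type*} [Field F] {n : ℕ} (l m : ℕ)
    (C : Submodule F (Fin n → F)) : Prop :=
  n = l * m ∧ 0 < m ∧ m.Coprime (ringChar F) ∧ ∀ c ∈ C, cyclicShift^[l] c ∈ C

/-- A binary cubic code: a binary `ℓ`-quasi-cyclic code of length `3 ℓ`. -/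
def IsBinaryCubic {n : ℕ} (C : Submodule (ZMod 2) (Fin n → ZMod 2)) : Prop :=
  ∃ l : ℕ, IsQuasiCyclic l 3 C

open Classical in
/-- The Hamming weight enumerator `∑_{c ∈ C} y ^ wt(c)`. -/
noncomputable def weightEnumerator {F : Type*} [Field F] [Fintype F] {n : ℕ}
    (C : Submodule F (Fin n → F)) : ℕ[X] :=
  ∑ c : Fin n → F with c ∈ C, X ^ hammingNorm c

/-- `W` has the form `W₄ = 1 + 3451 y¹² + 24128 y¹⁴ + 336081 y¹⁶ + ⋯`, the dots standing for
arbitrary terms of degree greater than 16. -/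
def HasFormW4 (W : ℕ[X]) : Prop :=
  ∀ i ≤ 16, W.coeff i =
    (1 + 3451 * X ^ 12 + 24128 * X ^ 14 + 336081 * X ^ 16 : ℕ[X]).coeff i

/-! The shift by 20 places permutes the codewords of each weight, and its cube is the identity. The
support of a fixed word is a union of 3-element orbits of coordinates, so its weight is a multiple
of 3. For a weight `w` not divisible by 3, all orbits on words of weight `w` therefore have size 3,
and 3 divides `A_w`. But 24128 is 2 modulo 3. -/

/-- A map of finite order `p`, `p` prime, without fixed points acts on a set whose size is divisible
by `p`. -/
theorem dvd_card_of_iterate_eq_self_of_no_fixedPoints {α : Type*} [Fintype α] {p : ℕ}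
    (hp : p.Prime) (f : α → α) (hf : ∀ a, f^[p] a = a) (hfix : ∀ a, f a ≠ a) :
    p ∣ Fintype.card α := by
  classical
  have : Fact p.Prime := ⟨hp⟩
  let g : Function.End α := f
  -- The fixed-point congruence is stated for order a power of `p`; here the exponent is 1.
  have hpow : g ^ p ^ 1 = 1 := by
    rw [pow_one]
    funext a
    exact (congrFun (hom_coe_pow (fun g : Function.End α => (g : α → α)) rfl
      (fun _ _ => rfl) g p) a).trans (hf a)
  have h := Equiv.Perm.card_fixedPoints_modEq hpow
  have : IsEmpty (Function.fixedPoints f) := ⟨fun a => hfix a.1 a.2⟩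
  rw [Fintype.card_eq_zero (α := Function.fixedPoints f)] at h
  exact (Nat.modEq_zero_iff_dvd).1 h

theorem iterate_cyclicShift {F : Type*} {n : ℕ} (l : ℕ) (c : Fin n → F) :
    cyclicShift^[l] c = c ∘ (finRotate n).symm^[l] := by
  induction l with
  | zero => rfl
  | succ l ih =>
    rw [Function.iterate_succ_apply', ih, Function.iterate_succ]
    rfl

theorem finRotate_symm_iterate_eq_sub {n : ℕ} (l : ℕ) (k : Fin (n + 1)) :
    (finRotate (n + 1)).symm^[l] k = k - l • 1 := by
  induction l with
  | zero => simp
  | succ l ih =>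
    rw [Function.iterate_succ_apply', ih, Equiv.symm_apply_eq, finRotate_apply]
    rw [add_smul, one_smul, ← sub_sub, sub_add_cancel]

theorem hammingNorm_comp_equiv {F ι : Type*} [Zero F] [DecidableEq F] [Fintype ι]
    (e : ι ≃ ι) (c : ι → F) : hammingNorm (c ∘ e) = hammingNorm c :=
  Finset.card_equiv e (by simp)

theorem hammingNorm_iterate_cyclicShift {F : Type*} [Zero F] [DecidableEq F] {n : ℕ}
    (l : ℕ) (c : Fin n → F) : hammingNorm (cyclicShift^[l] c) = hammingNorm c := by
  induction l with
  | zero => rfl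
  | succ l ih =>
    rw [Function.iterate_succ_apply', ← ih]
    exact hammingNorm_comp_equiv (finRotate n).symm _

theorem cyclicShift_twenty_iterate_three {F : Type*} (c : Fin 60 → F) :
    (cyclicShift^[20])^[3] c = c := by
  rw [← Function.iterate_mul, iterate_cyclicShift]
  funext k
  rw [Function.comp_apply, finRotate_symm_iterate_eq_sub]
  -- The total shift `(20 * 3) • 1` reduces to 0 in `Fin 60`.
  exact congrArg c (sub_zero k)

/-- A word fixed by the shift by a third of its length has weight divisible by `3`. -/
theorem three_dvd_hammingNorm_of_fixed {F : Type*} [Zero F] [DecidableEq F] (c : Fin 60 → F)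
    (hc : cyclicShift^[20] c = c) : 3 ∣ hammingNorm c := by
  have hshift (k : Fin 60) : c (k - 20) = c k := by
    conv_rhs => rw [← hc, iterate_cyclicShift]
    rw [Function.comp_apply, finRotate_symm_iterate_eq_sub]
    rfl
  have h := dvd_card_of_iterate_eq_self_of_no_fixedPoints Nat.prime_three
    (fun k : {k // c k ≠ 0} => ⟨k.1 - 20, by rw [hshift]; exact k.2⟩)
    (fun k => Subtype.ext (by
      change k.1 - 20 - 20 - 20 = k.1
      rw [sub_sub, sub_sub]
      exact sub_zero k.1))
    (fun k h => absurd (sub_eq_self.1 (congrArg Subtype.val h)) (by decide))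
  rwa [Fintype.card_subtype] at h

open Classical in
theorem coeff_weightEnumerator {F : Type*} [Field F] [Fintype F] {n : ℕ}
    (C : Submodule F (Fin n → F)) (w : ℕ) :
    (weightEnumerator C).coeff w = Fintype.card {c : Fin n → F // c ∈ C ∧ hammingNorm c = w} := by
  rw [weightEnumerator, finsetSum_coeff, Fintype.card_subtype, ← Finset.filter_filter,
    Finset.card_filter]
  simp only [coeff_X_pow, eq_comm]

/-- In a code invariant under the shift by a third of its length, the number of words of a weight
not divisible by `3` is divisible by `3`. -/
theorem three_dvd_coeff_weightEnumerator {F : Type*} [Field F] [Fintype F]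
    (C : Submodule F (Fin 60 → F)) (hC : ∀ c ∈ C, cyclicShift^[20] c ∈ C) {w : ℕ}
    (hw : ¬ 3 ∣ w) : 3 ∣ (weightEnumerator C).coeff w := by
  classical
  rw [coeff_weightEnumerator]
  have h := dvd_card_of_iterate_eq_self_of_no_fixedPoints Nat.prime_three
    (fun c : {c : Fin 60 → F // c ∈ C ∧ hammingNorm c = w} =>
      ⟨cyclicShift^[20] c.1, hC _ c.2.1, (hammingNorm_iterate_cyclicShift 20 c.1).trans c.2.2⟩)
    (fun c => Subtype.ext (cyclicShift_twenty_iterate_three c.1))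
    (fun c h => by
      rw [Subtype.ext_iff] at h
      dsimp only at h
      have hfixed := three_dvd_hammingNorm_of_fixed c.1 h
      rw [c.2.2] at hfixed
      exact hw hfixed)
  convert h

theorem mainTheorem5 :
    ¬ ∃ C : Submodule (ZMod 2) (Fin 60 → ZMod 2),
      IsBinaryCubic C ∧ IsSelfDualCode C ∧ IsLinearCode 30 12 C ∧
        HasFormW4 (weightEnumerator C) := by
  rintro ⟨C, ⟨l, hl, -, -, hC⟩, -, -, hW⟩
  obtain rfl : l = 20 := by omega
  -- Only weight 14 obstructs: 12 is a multiple of 3, and so is 336081.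
  have hdvd := three_dvd_coeff_weightEnumerator C hC (w := 14) (by decide)
  rw [hW 14 (by decide)] at hdvd
  have hcoeff : (1 + 3451 * X ^ 12 + 24128 * X ^ 14 + 336081 * X ^ 16 : ℕ[X]).coeff 14 = 24128 := by
    simp [coeff_one, coeff_X_pow, coeff_ofNat_mul]
  rw [hcoeff] at hdvd
  exact absurd hdvd (by norm_num)
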